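/- (Ramanujan's formula for odd zeta values.) Let $\zeta$ be the (analytically continued) Riemann zeta function and let $B_n$ be the Bernoulli numbers, $\frac{t}{e^t-1}=\sum_{n\ge 0}B_n\frac{t^n}{n!}$. For every non-zero integer $m$ and all real $\alpha,\beta>0$ with $\alpha\beta=\pi^2$, the two infinite series below converge and $$\alpha^{-m}\left\{\frac12\zeta(2m+1)+\sum_{n=1}^\infty\frac{n^{-2m-1}}{e^{2n\alpha}-1}\right\} =(-\beta)^{-m}\left\{\frac12\zeta(2m+1)+\sum_{n=1}^\infty\frac{n^{-2m-1}}{e^{2n\beta}-1}\right\} -2^{2m}\sum_{j=0}^{m+1}\frac{(-1)^jB_{2j}B_{2m+2-2j}}{(2j)!\,(2m+2-2j)!}\,\alpha^{m+1-j}\beta^j,$$ where the finite sum over $j$ is empty (equal to $0$) if $m\le -2$. -/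

import Mathlib

open scoped Nat

/-! ### Convergence of the series and its q-expansion -/

section LambertSeries

/-! The sign of `m` decides which mechanism gives the formula.

For `m = -p < 0`, the bracket is a multiple of the weight `2p` Eisenstein series at `τ = iα/π`,
where `q = exp(-2α)`. Since `αβ = π²`, the map `τ ↦ -1/τ` exchanges `iα/π` and `iβ/π`, so modularity
is the claim for `p ≥ 2` (`ramanujan_of_le_neg_two`). For `p = 1` the quasi-modularity of `G2` adds
the constant `1/4` (`ramanujan_neg_one`).

For `m > 0`, the partial fractions of the cotangent turn the series into the double sum of `1 /
(n^(2m) (n²α + k²β))`, up to zeta values (`tsum_one_div_pow_mul_quadratic`). Exchanging `α` and `β`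
amounts to exchanging `n` and `k`; the weighted difference of the two summands is a finite geometric
sum, which factors into products of even zeta values (`tsum_quadratic_sub_tsum_quadratic_swap`).
Euler's formula makes these Bernoulli numbers. -/

lemma inv_exp_sub_one_eq_geometric (α : ℝ) (hα : 0 < α) (n : ℕ+) :
    1 / (Real.exp (2 * n * α) - 1) =
      Real.exp (-(2 * α)) ^ (n : ℕ) / (1 - Real.exp (-(2 * α)) ^ (n : ℕ)) := by
  have hn : (0 : ℝ) < n := by exact_mod_cast n.pos
  have h1 : Real.exp (-(2 * α)) ^ (n : ℕ) = (Real.exp (2 * n * α))⁻¹ := by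
    rw [← Real.exp_nat_mul, ← Real.exp_neg]
    ring_nf
  have h2 : 1 < Real.exp (2 * n * α) := Real.one_lt_exp_iff.2 (by positivity)
  rw [h1]
  have h3 : Real.exp (2 * n * α) - 1 ≠ 0 := by linarith
  have h4 : Real.exp (2 * n * α) ≠ 0 := (Real.exp_pos _).ne'
  field_simp

lemma summable_zpow_div_exp_sub_one (s : ℤ) {α : ℝ} (hα : 0 < α) :
    Summable fun n : ℕ+ => (n : ℝ) ^ s / (Real.exp (2 * n * α) - 1) := by
  have hr : ‖Real.exp (-(2 * α))‖ < 1 := by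
    rw [Real.norm_eq_abs, abs_of_pos (Real.exp_pos _), Real.exp_lt_one_iff]
    linarith
  have h := (summable_norm_pow_mul_geometric_div_one_sub (𝕜 := ℝ) s.toNat hr).comp_injective
    PNat.coe_injective
  refine Summable.of_nonneg_of_le (fun n => ?_) (fun n => ?_) h
  · have hn : (0 : ℝ) < n := by exact_mod_cast n.pos
    have h2 : 1 < Real.exp (2 * n * α) := Real.one_lt_exp_iff.2 (by positivity)
    have : 0 < Real.exp (2 * n * α) - 1 := by linarith
    positivity
  · have hn : (0 : ℝ) < n := by exact_mod_cast n.pos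
    have h1 : (1 : ℝ) ≤ n := by exact_mod_cast n.pos
    have h2 : 1 < Real.exp (2 * n * α) := Real.one_lt_exp_iff.2 (by positivity)
    have : 0 < Real.exp (2 * n * α) - 1 := by linarith
    -- For negative `s`, `toNat` gives 0; the bound survives because `n ≥ 1`.
    have h3 : (n : ℝ) ^ s ≤ (n : ℝ) ^ s.toNat := by
      rw [← zpow_natCast]
      exact zpow_le_zpow_right₀ h1 (Int.self_le_toNat s)
    simp only [Function.comp_apply]
    rw [mul_div_assoc, ← inv_exp_sub_one_eq_geometric α hα n, div_eq_mul_one_div]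
    gcongr

open scoped ArithmeticFunction.sigma in
lemma tsum_pow_div_exp_sub_one_eq_tsum_sigma (k : ℕ) {α : ℝ} (hα : 0 < α) :
    ((∑' n : ℕ+, (n : ℝ) ^ k / (Real.exp (2 * n * α) - 1) : ℝ) : ℂ) =
      ∑' n : ℕ+, (σ k n : ℂ) * (Real.exp (-(2 * α)) : ℂ) ^ (n : ℕ) := by
  have hr : ‖(Real.exp (-(2 * α)) : ℂ)‖ < 1 := by
    rw [Complex.norm_real, Real.norm_eq_abs, abs_of_pos (Real.exp_pos _), Real.exp_lt_one_iff]
    linarith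
  rw [← tsum_pow_div_one_sub_eq_tsum_sigma hr, Complex.ofReal_tsum]
  refine tsum_congr fun n => ?_
  rw [div_eq_mul_one_div, inv_exp_sub_one_eq_geometric α hα n]
  push_cast
  ring

end LambertSeries

/-! ### Negative `m`: modularity of Eisenstein series -/

section NegativeIndex

open UpperHalfPlane hiding I
open Complex ModularGroup EisensteinSeries
open scoped ArithmeticFunction.sigma

/-- The point `i α / π` of the upper half-plane, whose nome is `exp (-2 α)`. -/
noncomputable def imaginaryPoint (α : ℝ) (hα : 0 < α) : ℍ :=
  ⟨I * (α / Real.pi : ℝ), by simpa using div_pos hα Real.pi_pos⟩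

lemma coe_imaginaryPoint {α : ℝ} (hα : 0 < α) :
    (imaginaryPoint α hα : ℂ) = I * (α / Real.pi) := by
  simp [imaginaryPoint]

lemma cexp_two_pi_I_imaginaryPoint {α : ℝ} (hα : 0 < α) :
    cexp (2 * Real.pi * I * imaginaryPoint α hα) = (Real.exp (-(2 * α)) : ℂ) := by
  have : (Real.pi : ℂ) ≠ 0 := by exact_mod_cast Real.pi_ne_zero
  rw [coe_imaginaryPoint, ofReal_exp]
  congr 1
  push_cast
  field_simp
  linear_combination (α : ℂ) * I_sq

lemma S_smul_imaginaryPoint {α β : ℝ} (hα : 0 < α) (hβ : 0 < β) (hαβ : α * β = Real.pi ^ 2) :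
    S • imaginaryPoint α hα = imaginaryPoint β hβ := by
  have hπ : (Real.pi : ℂ) ≠ 0 := by exact_mod_cast Real.pi_ne_zero
  have hα' : (α : ℂ) ≠ 0 := by exact_mod_cast hα.ne'
  have h : (α : ℂ) * β = Real.pi ^ 2 := by exact_mod_cast hαβ
  rw [UpperHalfPlane.ext_iff, modular_S_smul]
  simp only [coe_imaginaryPoint]
  refine inv_eq_of_mul_eq_one_right ?_
  field_simp
  linear_combination -(h * I ^ 2) - Real.pi ^ 2 * I_sq

/-- The q-expansion of `E`, rescaled so that its constant term becomes `ζ(1-2p)/2 = -B_{2p}/(4p)`.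
-/
lemma eisenstein_imaginaryPoint {p : ℕ} (hk : 3 ≤ 2 * p) {α : ℝ} (hα : 0 < α) :
    1 / 2 * riemannZeta (1 - 2 * p) +
        ((∑' n : ℕ+, (n : ℝ) ^ (2 * p - 1) / (Real.exp (2 * n * α) - 1) : ℝ) : ℂ) =
      -(bernoulli (2 * p) / (4 * p) : ℂ) * ModularForm.E hk (imaginaryPoint α hα) := by
  -- The normalised q-expansion divides by `B_{2p}`, nonzero because `ζ(2p) ≠ 0`.
  have hB : (bernoulli (2 * p) : ℂ) ≠ 0 := by
    have h := riemannZeta_two_mul_nat (k := p) (by omega)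
    intro h0
    rw [h0] at h
    refine riemannZeta_ne_zero_of_one_le_re (s := 2 * p) ?_ (by simpa using h)
    have : (1 : ℝ) ≤ 2 * p := by exact_mod_cast (by omega : 1 ≤ 2 * p)
    simpa using this
  have hp : (p : ℂ) ≠ 0 := by exact_mod_cast (by omega : p ≠ 0)
  have hz : riemannZeta (1 - 2 * p) = -(bernoulli (2 * p) : ℂ) / (2 * p) := by
    have h := riemannZeta_neg_nat_eq_bernoulli (2 * p - 1)
    have h1 : ((2 * p - 1 : ℕ) : ℂ) = 2 * p - 1 := by
      rw [Nat.cast_sub (by omega)]; push_cast; ring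
    rw [Odd.neg_one_pow ⟨p - 1, by omega⟩, h1, Nat.sub_add_cancel (by omega)] at h
    rw [show (1 : ℂ) - 2 * p = -(2 * p - 1) by ring, h]
    ring
  rw [q_expansion_bernoulli hk (even_two_mul p), tsum_pow_div_exp_sub_one_eq_tsum_sigma _ hα, hz,
    cexp_two_pi_I_imaginaryPoint hα]
  simp only [zpow_natCast]
  push_cast
  field_simp
  ring

lemma E_imaginaryPoint_transform {p : ℕ} (hk : 3 ≤ 2 * p) {α β : ℝ} (hα : 0 < α) (hβ : 0 < β)
    (hαβ : α * β = Real.pi ^ 2) :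
    ModularForm.E hk (imaginaryPoint β hβ) =
      (-1) ^ p * (α / Real.pi : ℂ) ^ (2 * p) * ModularForm.E hk (imaginaryPoint α hα) := by
  have h := SlashInvariantForm.slash_action_eqn'' (ModularForm.E hk)
    (show (S : Matrix.GeneralLinearGroup (Fin 2) ℝ) ∈
      (Matrix.SpecialLinearGroup.mapGL ℝ : Matrix.SpecialLinearGroup (Fin 2) ℤ →* _).range
      from ⟨S, rfl⟩) (imaginaryPoint α hα)
  have hd : denom (S : Matrix.GeneralLinearGroup (Fin 2) ℝ) (imaginaryPoint α hα) =
      imaginaryPoint α hα :=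
    denom_S (imaginaryPoint α hα)
  rw [hd] at h
  rw [← S_smul_imaginaryPoint hα hβ hαβ]
  refine h.trans ?_
  rw [coe_imaginaryPoint, zpow_natCast, mul_pow, pow_mul, I_sq]

lemma ramanujan_of_le_neg_two {p : ℕ} (hp : 2 ≤ p) {α β : ℝ} (hα : 0 < α) (hβ : 0 < β)
    (hαβ : α * β = Real.pi ^ 2) :
    (α : ℂ) ^ p * (1 / 2 * riemannZeta (1 - 2 * p) +
        ((∑' n : ℕ+, (n : ℝ) ^ (2 * p - 1) / (Real.exp (2 * n * α) - 1) : ℝ) : ℂ)) =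
      (-(β : ℂ)) ^ p * (1 / 2 * riemannZeta (1 - 2 * p) +
        ((∑' n : ℕ+, (n : ℝ) ^ (2 * p - 1) / (Real.exp (2 * n * β) - 1) : ℝ) : ℂ)) := by
  have hk : 3 ≤ 2 * p := by omega
  have hπ : (Real.pi : ℂ) ≠ 0 := by exact_mod_cast Real.pi_ne_zero
  have h : (α : ℂ) * β = Real.pi ^ 2 := by exact_mod_cast hαβ
  rw [eisenstein_imaginaryPoint hk hα, eisenstein_imaginaryPoint hk hβ,
    E_imaginaryPoint_transform hk hα hβ hαβ]
  have : (-(β : ℂ)) ^ p * ((-1) ^ p * (α / Real.pi : ℂ) ^ (2 * p)) = (α : ℂ) ^ p := by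
    rw [pow_mul, ← mul_pow, ← mul_pow]
    congr 1
    field_simp
    linear_combination (α : ℂ) * h
  rw [← this]
  ring

/-- The `1/4` comes from the extra term in the transformation of `G2` under `S`. -/
lemma ramanujan_neg_one {α β : ℝ} (hα : 0 < α) (hβ : 0 < β) (hαβ : α * β = Real.pi ^ 2) :
    (α : ℂ) * (1 / 2 * riemannZeta (-1) +
        ((∑' n : ℕ+, (n : ℝ) / (Real.exp (2 * n * α) - 1) : ℝ) : ℂ)) =
      -(β : ℂ) * (1 / 2 * riemannZeta (-1) +
        ((∑' n : ℕ+, (n : ℝ) / (Real.exp (2 * n * β) - 1) : ℝ) : ℂ)) - 1 / 4 := by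
  have hπ : (Real.pi : ℂ) ≠ 0 := by exact_mod_cast Real.pi_ne_zero
  have hα' : (α : ℂ) ≠ 0 := by exact_mod_cast hα.ne'
  have h : (α : ℂ) * β = Real.pi ^ 2 := by exact_mod_cast hαβ
  have hz : riemannZeta (-1) = -1 / 12 := by
    have := riemannZeta_neg_nat_eq_bernoulli 1
    norm_num [bernoulli_two] at this
    rw [this]; norm_num
  have hS := G2_S_transform (imaginaryPoint α hα)
  rw [S_smul_imaginaryPoint hα hβ hαβ, G2_eq_tsum_cexp, G2_eq_tsum_cexp,
    cexp_two_pi_I_imaginaryPoint, cexp_two_pi_I_imaginaryPoint,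
    ← tsum_pow_div_exp_sub_one_eq_tsum_sigma _ hα, ← tsum_pow_div_exp_sub_one_eq_tsum_sigma _ hβ,
    riemannZeta_two, coe_imaginaryPoint] at hS
  simp only [pow_one] at hS
  rw [hz]
  generalize ((∑' n : ℕ+, (n : ℝ) / (Real.exp (2 * n * α) - 1) : ℝ) : ℂ) = a at *
  generalize ((∑' n : ℕ+, (n : ℝ) / (Real.exp (2 * n * β) - 1) : ℝ) : ℂ) = b at *
  rw [mul_pow, I_sq] at hS
  field_simp at hS
  refine mul_left_cancel₀ hα' ?_
  linear_combination (-1 / 48 : ℂ) * hS - (1 / 24 - b) * h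

end NegativeIndex

/-! ### Positive `m`: cotangent expansion and a symmetric double sum -/

section PositiveIndex

lemma summable_one_div_pnat_pow {j : ℕ} (hj : 1 < j) :
    Summable fun n : ℕ+ => 1 / (n : ℝ) ^ j :=
  (Real.summable_one_div_nat_pow.2 hj).comp_injective PNat.coe_injective

/-- The Mittag-Leffler expansion of `π cot(πz)` at `z = ix/π`. -/
lemma hasSum_inv_sq_add_sq {x : ℝ} (hx : 0 < x) :
    HasSum (fun k : ℕ+ => x / (x ^ 2 + Real.pi ^ 2 * (k : ℝ) ^ 2))
      (1 / (Real.exp (2 * x) - 1) + 1 / 2 - 1 / (2 * x)) := by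
  have hs : Summable fun k : ℕ+ => x / (x ^ 2 + Real.pi ^ 2 * (k : ℝ) ^ 2) := by
    have h : Summable fun k : ℕ+ => x / Real.pi ^ 2 * (1 / (k : ℝ) ^ 2) :=
      (summable_one_div_pnat_pow one_lt_two).mul_left _
    refine Summable.of_nonneg_of_le (fun k => by positivity) (fun k => ?_) h
    have hk : (0 : ℝ) < k := by exact_mod_cast k.pos
    rw [div_mul_div_comm, mul_one]
    gcongr
    nlinarith
  rw [hs.hasSum_iff]
  have hπ : (Real.pi : ℂ) ≠ 0 := by exact_mod_cast Real.pi_ne_zero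
  have hx' : (x : ℂ) ≠ 0 := by exact_mod_cast hx.ne'
  set z : ℂ := Complex.I * (x / Real.pi : ℝ) with hz
  have him : z.im ≠ 0 := by simpa [hz] using (div_pos hx Real.pi_pos).ne'
  have hmem : z ∈ Complex.integerComplement := by
    rintro ⟨n, hn⟩
    exact him (by simp [← hn])
  have hcot := cot_series_rep hmem
  have hterm : ∀ k : ℕ+, 1 / (z - k) + 1 / (z + k) =
      -2 * Complex.I * Real.pi * ((x / (x ^ 2 + Real.pi ^ 2 * (k : ℝ) ^ 2) : ℝ) : ℂ) := by
    intro k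
    have h1 : z - k ≠ 0 := fun h => him (by simpa using congrArg Complex.im h)
    have h2 : z + k ≠ 0 := fun h => him (by simpa using congrArg Complex.im h)
    have h3 : ((x ^ 2 + Real.pi ^ 2 * (k : ℝ) ^ 2 : ℝ) : ℂ) =
        -Real.pi ^ 2 * ((z - k) * (z + k)) := by
      rw [hz]
      push_cast
      field_simp
      linear_combination (x : ℂ) ^ 2 * Complex.I_sq
    rw [Complex.ofReal_div, h3, one_div_add_one_div h1 h2]
    field_simp
    rw [hz]
    push_cast
    field_simp
    ring
  simp_rw [hterm] at hcot
  rw [tsum_mul_left, ← Complex.ofReal_tsum, Complex.cot_pi_eq_exp_ratio] at hcot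
  have hexp : Complex.exp (2 * Real.pi * Complex.I * z) = ((Real.exp (2 * x))⁻¹ : ℝ) := by
    rw [← Real.exp_neg, Complex.ofReal_exp]
    congr 1
    rw [hz]
    push_cast
    field_simp
    linear_combination Complex.I_sq
  rw [hexp] at hcot
  have he : 1 < Real.exp (2 * x) := Real.one_lt_exp_iff.2 (by positivity)
  generalize Real.exp (2 * x) = e at *
  have he1 : (e : ℂ) - 1 ≠ 0 := by exact_mod_cast (sub_pos.2 he).ne'
  have he0 : (e : ℂ) ≠ 0 := by exact_mod_cast (zero_lt_one.trans he).ne'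
  apply Complex.ofReal_injective
  generalize (∑' k : ℕ+, x / (x ^ 2 + Real.pi ^ 2 * (k : ℝ) ^ 2) : ℝ) = t at *
  rw [hz] at hcot
  push_cast at hcot ⊢
  field_simp at hcot ⊢
  linear_combination -hcot + (e - 1) * 2 * x * t * Complex.I_sq

lemma ofReal_tsum_one_div_pnat_pow {j : ℕ} (hj : 1 < j) :
    ((∑' n : ℕ+, 1 / (n : ℝ) ^ j : ℝ) : ℂ) = riemannZeta j := by
  rw [zeta_nat_eq_tsum_of_gt_one hj, Complex.ofReal_tsum]
  have hs : Summable fun n : ℕ => (1 : ℂ) / (n : ℂ) ^ j := by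
    have := Complex.ofRealCLM.summable (Real.summable_one_div_nat_pow.2 hj)
    simpa using this
  rw [← tsum_zero_pnat_eq_tsum_nat hs]
  simp [show j ≠ 0 by omega]

lemma summable_one_div_pow_mul_quadratic {m : ℕ} (hm : 1 ≤ m) {α β : ℝ} (hα : 0 < α) (hβ : 0 < β) :
    Summable fun p : ℕ+ × ℕ+ =>
      1 / ((p.1 : ℝ) ^ (2 * m) * ((p.1 : ℝ) ^ 2 * α + (p.2 : ℝ) ^ 2 * β)) := by
  have h := (Summable.mul_of_nonneg (summable_one_div_pnat_pow (j := 2 * m) (by omega))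
    (summable_one_div_pnat_pow (j := 2) (by omega)) (fun n => by positivity)
    (fun n => by positivity)).mul_left β⁻¹
  refine Summable.of_nonneg_of_le (fun p => by positivity) (fun p => ?_) h
  have h1 : (0 : ℝ) < p.1 := by exact_mod_cast p.1.pos
  have h2 : (0 : ℝ) < p.2 := by exact_mod_cast p.2.pos
  rw [← one_div, one_div_mul_one_div, one_div_mul_one_div]
  apply one_div_le_one_div_of_le (by positivity)
  have : 0 < (p.1 : ℝ) ^ (2 * m) * ((p.1 : ℝ) ^ 2 * α) := by positivity
  linarith

/-- Sum over the second index first, with `x = nα` in `hasSum_inv_sq_add_sq`; `π² = αβ` cancels a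
factor `α`. -/
lemma tsum_one_div_pow_mul_quadratic {m : ℕ} (hm : 1 ≤ m) {α β : ℝ} (hα : 0 < α) (hβ : 0 < β)
    (hαβ : α * β = Real.pi ^ 2)
    (hs : Summable fun n : ℕ+ => 1 / (n : ℝ) ^ (2 * m + 1) / (Real.exp (2 * n * α) - 1)) :
    ∑' p : ℕ+ × ℕ+, 1 / ((p.1 : ℝ) ^ (2 * m) * ((p.1 : ℝ) ^ 2 * α + (p.2 : ℝ) ^ 2 * β)) =
      ∑' n : ℕ+, 1 / (n : ℝ) ^ (2 * m + 1) / (Real.exp (2 * n * α) - 1) +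
        1 / 2 * ∑' n : ℕ+, 1 / (n : ℝ) ^ (2 * m + 1) -
        1 / (2 * α) * ∑' n : ℕ+, 1 / (n : ℝ) ^ (2 * (m + 1)) := by
  have hd := (summable_one_div_pow_mul_quadratic hm hα hβ).hasSum
  have hfib : ∀ n : ℕ+, HasSum
      (fun k : ℕ+ => 1 / ((n : ℝ) ^ (2 * m) * ((n : ℝ) ^ 2 * α + (k : ℝ) ^ 2 * β)))
      (1 / (n : ℝ) ^ (2 * m + 1) / (Real.exp (2 * n * α) - 1) +
        1 / 2 * (1 / (n : ℝ) ^ (2 * m + 1)) - 1 / (2 * α) * (1 / (n : ℝ) ^ (2 * (m + 1)))) := by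
    intro n
    have hn : (0 : ℝ) < n := by exact_mod_cast n.pos
    convert! (hasSum_inv_sq_add_sq (mul_pos hn hα)).mul_left (1 / (n : ℝ) ^ (2 * m + 1)) using 1
    · ext k
      have hk : (0 : ℝ) < k := by exact_mod_cast k.pos
      rw [← hαβ, pow_succ]
      have : (n : ℝ) ^ 2 * α + (k : ℝ) ^ 2 * β ≠ 0 := by positivity
      field_simp
      ring
    · rw [← mul_assoc 2 (n : ℝ) α]
      have : (n : ℝ) ^ (2 * (m + 1)) = (n : ℝ) ^ (2 * m + 1) * n := by ring
      rw [this]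
      field_simp
  refine (hd.prod_fiberwise hfib).unique ?_
  exact (hs.hasSum.add ((summable_one_div_pnat_pow (by omega)).hasSum.mul_left _)).sub
    ((summable_one_div_pnat_pow (by omega)).hasSum.mul_left _)

/-- Geometric sum in `A⁻¹` and `(-B)⁻¹`, whose difference `(A + B)/(AB)` cancels the denominator. -/
lemma inv_pow_sub_inv_pow_div_add {A B : ℝ} (hA : 0 < A) (hB : 0 < B) (m : ℕ) :
    A⁻¹ ^ m / (A + B) - (-B)⁻¹ ^ m / (A + B) =
      -∑ i ∈ Finset.range m, A⁻¹ ^ (i + 1) * (-B)⁻¹ ^ (m - i) := by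
  have h := geom_sum₂_mul A⁻¹ (-B)⁻¹ m
  have h2 : A⁻¹ - (-B)⁻¹ = (A + B) * (-(A⁻¹ * (-B)⁻¹)) := by field_simp; ring
  rw [← sub_div, ← h, h2]
  have h3 : A + B ≠ 0 := by positivity
  rw [mul_left_comm, mul_div_cancel_left₀ _ h3, mul_neg, Finset.sum_mul]
  congr 1
  refine Finset.sum_congr rfl fun i hi => ?_
  have : m - i = m - 1 - i + 1 := by have := Finset.mem_range.1 hi; omega
  rw [this]
  ring

lemma tsum_quadratic_sub_tsum_quadratic_swap {m : ℕ} (hm : 1 ≤ m) {α β : ℝ} (hα : 0 < α) (hβ : 0 < β) :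
    α⁻¹ ^ m * (∑' p : ℕ+ × ℕ+,
        1 / ((p.1 : ℝ) ^ (2 * m) * ((p.1 : ℝ) ^ 2 * α + (p.2 : ℝ) ^ 2 * β))) -
      (-β)⁻¹ ^ m * (∑' p : ℕ+ × ℕ+,
        1 / ((p.1 : ℝ) ^ (2 * m) * ((p.1 : ℝ) ^ 2 * β + (p.2 : ℝ) ^ 2 * α))) =
      -∑ i ∈ Finset.range m, α⁻¹ ^ (i + 1) * (-β)⁻¹ ^ (m - i) *
        ((∑' n : ℕ+, 1 / (n : ℝ) ^ (2 * (i + 1))) * ∑' n : ℕ+, 1 / (n : ℝ) ^ (2 * (m - i))) := by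
  have h1 := (summable_one_div_pow_mul_quadratic hm hα hβ).hasSum.mul_left (α⁻¹ ^ m)
  -- Swapping the indices gives both series the denominator `n²α + k²β`.
  have h2 := ((Equiv.prodComm ℕ+ ℕ+).hasSum_iff.2 (summable_one_div_pow_mul_quadratic hm hβ hα).hasSum).mul_left
    ((-β)⁻¹ ^ m)
  refine (h1.sub h2).unique ?_
  have h3 : ∀ i ∈ Finset.range m, HasSum (fun p : ℕ+ × ℕ+ => α⁻¹ ^ (i + 1) * (-β)⁻¹ ^ (m - i) *
      (1 / (p.1 : ℝ) ^ (2 * (i + 1)) * (1 / (p.2 : ℝ) ^ (2 * (m - i)))))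
      (α⁻¹ ^ (i + 1) * (-β)⁻¹ ^ (m - i) *
        ((∑' n : ℕ+, 1 / (n : ℝ) ^ (2 * (i + 1))) * ∑' n : ℕ+, 1 / (n : ℝ) ^ (2 * (m - i)))) := by
    intro i hi
    have hi := Finset.mem_range.1 hi
    have s1 := summable_one_div_pnat_pow (j := 2 * (i + 1)) (by omega)
    have s2 := summable_one_div_pnat_pow (j := 2 * (m - i)) (by omega)
    exact (s1.hasSum.mul s2.hasSum (s1.mul_of_nonneg s2 (fun n => by positivity)
      (fun n => by positivity))).mul_left _
  convert (hasSum_sum h3).neg using 1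
  ext p
  have hn : (0 : ℝ) < p.1 := by exact_mod_cast p.1.pos
  have hk : (0 : ℝ) < p.2 := by exact_mod_cast p.2.pos
  have key := inv_pow_sub_inv_pow_div_add (A := (p.1 : ℝ) ^ 2 * α) (B := (p.2 : ℝ) ^ 2 * β)
    (by positivity) (by positivity) m
  simp only [Function.comp_apply, Equiv.prodComm_apply, Prod.fst_swap, Prod.snd_swap]
  convert key using 1
  · rw [add_comm ((p.2 : ℝ) ^ 2 * β)]
    generalize (p.1 : ℝ) ^ 2 * α + (p.2 : ℝ) ^ 2 * β = c
    ring
  · congr 1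
    refine Finset.sum_congr rfl fun i hi => ?_
    ring

lemma ramanujan_of_pos {m : ℕ} (hm : 1 ≤ m) {α β : ℝ} (hα : 0 < α) (hβ : 0 < β)
    (hαβ : α * β = Real.pi ^ 2)
    (hsα : Summable fun n : ℕ+ => 1 / (n : ℝ) ^ (2 * m + 1) / (Real.exp (2 * n * α) - 1))
    (hsβ : Summable fun n : ℕ+ => 1 / (n : ℝ) ^ (2 * m + 1) / (Real.exp (2 * n * β) - 1)) :
    (α : ℂ)⁻¹ ^ m * (1 / 2 * riemannZeta (2 * m + 1) +
        ((∑' n : ℕ+, 1 / (n : ℝ) ^ (2 * m + 1) / (Real.exp (2 * n * α) - 1) : ℝ) : ℂ)) =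
      (-(β : ℂ))⁻¹ ^ m * (1 / 2 * riemannZeta (2 * m + 1) +
        ((∑' n : ℕ+, 1 / (n : ℝ) ^ (2 * m + 1) / (Real.exp (2 * n * β) - 1) : ℝ) : ℂ)) -
      ∑ j ∈ Finset.range (m + 2), (α : ℂ)⁻¹ ^ j * (-(β : ℂ))⁻¹ ^ (m + 1 - j) *
        (riemannZeta (2 * j) * riemannZeta (2 * (m + 1 - j : ℕ))) := by
  have hodd : ((∑' n : ℕ+, 1 / (n : ℝ) ^ (2 * m + 1) : ℝ) : ℂ) = riemannZeta (2 * m + 1) := by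
    rw [ofReal_tsum_one_div_pnat_pow (by omega)]
    push_cast
    rfl
  have heven : ∀ j : ℕ, 1 ≤ j →
      ((∑' n : ℕ+, 1 / (n : ℝ) ^ (2 * j) : ℝ) : ℂ) = riemannZeta (2 * j) := by
    intro j hj
    rw [ofReal_tsum_one_div_pnat_pow (by omega)]
    push_cast
    rfl
  have h := congrArg Complex.ofReal (tsum_quadratic_sub_tsum_quadratic_swap hm hα hβ)
  rw [tsum_one_div_pow_mul_quadratic hm hα hβ hαβ hsα, tsum_one_div_pow_mul_quadratic hm hβ hα (by rw [mul_comm, hαβ]) hsβ] at h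
  have hsum : ((∑ i ∈ Finset.range m, α⁻¹ ^ (i + 1) * (-β)⁻¹ ^ (m - i) *
        ((∑' n : ℕ+, 1 / (n : ℝ) ^ (2 * (i + 1))) * ∑' n : ℕ+, 1 / (n : ℝ) ^ (2 * (m - i))) : ℝ)
        : ℂ) = ∑ i ∈ Finset.range m, (α : ℂ)⁻¹ ^ (i + 1) * (-(β : ℂ))⁻¹ ^ (m - i) *
        (riemannZeta (2 * (i + 1 : ℕ)) * riemannZeta (2 * (m - i : ℕ))) := by
    rw [Complex.ofReal_sum]
    refine Finset.sum_congr rfl fun i hi => ?_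
    have hi := Finset.mem_range.1 hi
    rw [Complex.ofReal_mul, Complex.ofReal_mul, Complex.ofReal_mul, heven _ (by omega),
      heven _ (by omega)]
    simp
  simp only [Complex.ofReal_sub, Complex.ofReal_mul, Complex.ofReal_add, Complex.ofReal_neg,
    hodd, hsum, heven _ (Nat.le_add_left 1 m)] at h
  -- The end terms `j = 0` and `j = m + 1`, where `ζ(0) = -1/2`, account for the `ζ(2m+2)` terms of
  -- the two double sums.
  rw [Finset.sum_range_succ, Finset.sum_range_succ']
  simp only [Nat.add_sub_add_right, Nat.sub_zero, Nat.sub_self, pow_zero, Nat.cast_zero, mul_zero,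
    riemannZeta_zero]
  push_cast at h ⊢
  rw [pow_succ, pow_succ]
  rw [inv_neg] at h ⊢
  linear_combination h

/-- Euler's formula yields `π^(2m+2) = (αβ)^(m+1)`, which turns the negative powers of `α` and `β`
into positive ones. -/
lemma zeta_mul_zeta_eq_bernoulli {m j : ℕ} (hj : j ≤ m + 1) {α β : ℝ} (hα : 0 < α) (hβ : 0 < β)
    (hαβ : α * β = Real.pi ^ 2) :
    (α : ℂ)⁻¹ ^ j * (-(β : ℂ))⁻¹ ^ (m + 1 - j) *
        (riemannZeta (2 * j) * riemannZeta (2 * (m + 1 - j : ℕ))) =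
      2 ^ (2 * m) * ((-1) ^ j * (bernoulli (2 * j) : ℂ) * (bernoulli (2 * (m + 1 - j)) : ℂ) /
        (((2 * j)! : ℂ) * ((2 * (m + 1 - j))! : ℂ)) * (α : ℂ) ^ (m + 1 - j) * (β : ℂ) ^ j) := by
  obtain ⟨l, hl⟩ := Nat.exists_eq_add_of_le hj
  rw [show m + 1 - j = l by omega, riemannZeta_two_mul_nat', riemannZeta_two_mul_nat']
  have h : (α : ℂ) * β = Real.pi ^ 2 := by exact_mod_cast hαβ
  have hα' : (α : ℂ) ≠ 0 := by exact_mod_cast hα.ne'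
  have hβ' : (β : ℂ) ≠ 0 := by exact_mod_cast hβ.ne'
  -- Integer exponents keep Euler's formula valid at index 0, with the factor `2⁻¹`.
  have h2 : (2 : ℂ) ^ (2 * j - 1 : ℤ) * (2 : ℂ) ^ (2 * l - 1 : ℤ) = 2 ^ (2 * m) := by
    rw [← zpow_add₀ two_ne_zero, ← zpow_natCast]
    congr 1
    push_cast
    omega
  have hα2 : (α : ℂ)⁻¹ ^ j * (α : ℂ) ^ j = 1 := by rw [← mul_pow, inv_mul_cancel₀ hα', one_pow]
  have hβ2 : (-(β : ℂ))⁻¹ ^ l * (β : ℂ) ^ l = (-1) ^ l := by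
    rw [← mul_pow, inv_neg, neg_mul, inv_mul_cancel₀ hβ']
  have h1 : ((-1 : ℂ) ^ l) * (-1) ^ l = 1 := by rw [← mul_pow]; norm_num
  rw [← h2, pow_mul (Real.pi : ℂ), pow_mul (Real.pi : ℂ), ← h, mul_pow, mul_pow, pow_succ, pow_succ]
  have hp : (α : ℂ)⁻¹ ^ j * (-(β : ℂ))⁻¹ ^ l * (((-1) ^ j * -1) * (α ^ j * β ^ j) *
      (((-1) ^ l * -1) * (α ^ l * β ^ l))) = (-1) ^ j * α ^ l * β ^ j := by
    linear_combination ((-1) ^ j * α ^ l * β ^ j * ((-1) ^ l * (-(β : ℂ))⁻¹ ^ l * β ^ l)) * hα2 +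
      ((-1) ^ j * α ^ l * β ^ j * (-1) ^ l) * hβ2 + ((-1) ^ j * α ^ l * β ^ j) * h1
  linear_combination ((2 : ℂ) ^ (2 * j - 1 : ℤ) * (2 : ℂ) ^ (2 * l - 1 : ℤ) *
    (bernoulli (2 * j) : ℂ) * (bernoulli (2 * l) : ℂ) / (((2 * j)! : ℂ) * ((2 * l)! : ℂ))) * hp

end PositiveIndex

/-! ### Assembly of the cases -/

theorem corollary1p2 (m : ℤ) (hm : m ≠ 0) (α β : ℝ) (hα : 0 < α) (hβ : 0 < β)
    (hαβ : α * β = Real.pi ^ 2) :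
    Summable (fun n : ℕ+ => (n : ℝ) ^ (-2 * m - 1) / (Real.exp (2 * n * α) - 1)) ∧
    Summable (fun n : ℕ+ => (n : ℝ) ^ (-2 * m - 1) / (Real.exp (2 * n * β) - 1)) ∧
    (α : ℂ) ^ (-m) *
        (1 / 2 * riemannZeta (2 * m + 1) +
          ((∑' n : ℕ+, (n : ℝ) ^ (-2 * m - 1) / (Real.exp (2 * n * α) - 1) : ℝ) : ℂ)) =
      (-(β : ℂ)) ^ (-m) *
          (1 / 2 * riemannZeta (2 * m + 1) +
            ((∑' n : ℕ+, (n : ℝ) ^ (-2 * m - 1) / (Real.exp (2 * n * β) - 1) : ℝ) : ℂ)) -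
        (2 : ℂ) ^ (2 * m) *
          ∑ j ∈ Finset.range (m + 2).toNat,
            (-1 : ℂ) ^ j * (bernoulli (2 * j) : ℂ) * (bernoulli (2 * m + 2 - 2 * j).toNat : ℂ) /
                (((2 * j)! : ℂ) * ((2 * m + 2 - 2 * j).toNat ! : ℂ)) *
              (α : ℂ) ^ (m + 1 - j) * (β : ℂ) ^ j := by
  have hsα := summable_zpow_div_exp_sub_one (-2 * m - 1) hα
  have hsβ := summable_zpow_div_exp_sub_one (-2 * m - 1) hβ
  refine ⟨hsα, hsβ, ?_⟩
  obtain ⟨p, rfl | rfl⟩ := m.eq_nat_or_neg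
  · have hp : 1 ≤ p := by omega
    have hpow : ∀ n : ℕ+, (n : ℝ) ^ (-2 * (p : ℤ) - 1) = 1 / (n : ℝ) ^ (2 * p + 1) := by
      intro n
      rw [show -2 * (p : ℤ) - 1 = -((2 * p + 1 : ℕ) : ℤ) by push_cast; ring, zpow_neg,
        zpow_natCast, one_div]
    simp only [hpow] at hsα hsβ ⊢
    have h := ramanujan_of_pos hp hα hβ hαβ hsα hsβ
    rw [zpow_neg, zpow_natCast, zpow_neg, zpow_natCast, ← inv_pow, ← inv_pow, Int.cast_natCast, h,
      show ((p : ℤ) + 2).toNat = p + 2 by omega, Finset.mul_sum]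
    congr 1
    refine Finset.sum_congr rfl fun j hj => ?_
    have hj : j ≤ p + 1 := by have := Finset.mem_range.1 hj; omega
    rw [zeta_mul_zeta_eq_bernoulli hj hα hβ hαβ,
      show (2 * (p : ℤ) + 2 - 2 * j).toNat = 2 * (p + 1 - j) by omega,
      show (p : ℤ) + 1 - j = ((p + 1 - j : ℕ) : ℤ) by omega, zpow_natCast,
      show 2 * (p : ℤ) = ((2 * p : ℕ) : ℤ) by push_cast; rfl, zpow_natCast]
  · have hpow : ∀ n : ℕ+, (n : ℝ) ^ (-2 * (-(p : ℤ)) - 1) = (n : ℝ) ^ (2 * p - 1) := by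
      intro n
      rw [← zpow_natCast]
      congr 1
      omega
    simp only [hpow, neg_neg, zpow_natCast]
    rcases (show p = 1 ∨ 2 ≤ p by omega) with rfl | hp
    -- At `m = -1` only `j = 0` remains, contributing `2^(-2) = 1/4`.
    · have h := ramanujan_neg_one hα hβ hαβ
      norm_num at h ⊢
      exact h
    · have h := ramanujan_of_le_neg_two hp hα hβ hαβ
      rw [show (-(p : ℤ) + 2).toNat = 0 by omega, Finset.range_zero, Finset.sum_empty, mul_zero,
        sub_zero]
      rw [show 2 * ((-(p : ℤ) : ℤ) : ℂ) + 1 = 1 - 2 * p by push_cast; ring]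
      exact h
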